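/- For $1\le p<\infty$ let $B^\infty_{\ell^p}=\{(x_n)_{n\ge1}\in\mathbb{R}^\infty : \sum_{n=1}^\infty |x_n|^p\le 1\}$. For $p<q\le\infty$ this is a subset of $\ell^q$, and $d_{\ell^q}$ denotes the $\ell^q$-distance on it. An mm-space is a triple $(X,d_X,\mu_X)$ where $d_X$ is a complete separable metric on $X$ and $\mu_X$ is a finite Borel measure. For $\kappa>0$, put $m_X=\mu_X(X)$ and $$\mathrm{ObsDiam}_{\mathbb{R}}(X;-\kappa)=\sup_{f}\ \inf\{\mathrm{diam}\,Y_0 : Y_0\subseteq\mathbb{R}\text{ Borel},\ (f_*\mu_X)(Y_0)\ge m_X-\kappa\},$$ the supremum being over all $1$-Lipschitz maps $f:X\to\mathbb{R}$. A sequence $(X_n)$ of mm-spaces is a Lévy family if $\lim_{n\to\infty}\mathrm{ObsDiam}_{\mathbb{R}}(X_n;-\kappa)=0$ for every $\kappa>0$. A topological group $G$ is a Lévy group if there are a right-invariant metric $d_G$ inducing its topology and an increasing sequence $G_1\subseteq G_2\subseteq\cdots$ of compact subgroups with dense union in $G$ such that the groups $G_n$, with the restrictions of $d_G$ and the normalized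 Haar measures, form a Lévy family. An action of a topological group $G$ on a metric space $(X,d)$ is bounded if for every $\varepsilon>0$ there is a neighborhood $U$ of the identity of $G$ such that $d(x,gx)<\varepsilon$ for all $g\in U$ and $x\in X$. It is uniformly equicontinuous if for every $\varepsilon>0$ there is $\delta>0$ such that $d(gx,gy)<\varepsilon$ for every $g\in G$ and all $x,y\in X$ with $d(x,y)<\delta$. **Corollary.** Let $1\le p<q\le\infty$. Then a Lévy group has no non-trivial bounded, uniformly equicontinuous action on $(B^\infty_{\ell^p},d_{\ell^q})$; that is, for every such action of a Lévy group $G$ we have $gx=x$ for all $g\in G$ and $x\in B^\infty_{\ell^p}$. -/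

import Mathlib

open MeasureTheory Filter Topology
open scoped ENNReal

/-- The partial diameter `diam(ν, m - κ)`, where `m = ν(Y)`: the infimum of the diameters of the
Borel sets `Y₀` with `ν(Y₀) ≥ m - κ`. The subtraction is truncated at `0`, which changes nothing
since every measure is nonnegative. -/
noncomputable def partialDiam {Y : Type*} [MetricSpace Y] [MeasurableSpace Y]
    (ν : Measure Y) (κ : ℝ) : ℝ≥0∞ :=
  ⨅ (Y₀ : Set Y) (_ : MeasurableSet Y₀) (_ : ν Set.univ - ENNReal.ofReal κ ≤ ν Y₀),
    Metric.ediam Y₀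

/-- The observable diameter `ObsDiam_Y(X; -κ)` of `(X, d, μ)`: the supremum of the partial diameters
of the push-forwards of `μ` under 1-Lipschitz maps `X → Y`. Both `X` and `Y` are meant to carry
their Borel σ-algebras. -/
noncomputable def obsDiam {X : Type*} [MetricSpace X] [MeasurableSpace X] (μ : Measure X)
    (Y : Type*) [MetricSpace Y] [MeasurableSpace Y] (κ : ℝ) : ℝ≥0∞ :=
  ⨆ (f : X → Y) (_ : LipschitzWith 1 f), partialDiam (μ.map f) κ

/-- A sequence of metric measure spaces is a Lévy family if its observable diameters with respect
to the real line tend to zero, for every `κ > 0`. -/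
def IsLevyFamily (X : ℕ → Type*) [∀ n, MetricSpace (X n)] [∀ n, MeasurableSpace (X n)]
    (μ : ∀ n, Measure (X n)) : Prop :=
  ∀ κ : ℝ, 0 < κ → Tendsto (fun n => obsDiam (μ n) ℝ κ) atTop (𝓝 0)

/-- For a group with a metric: the metric is right-invariant, and there is an increasing sequence
of compact subgroups with dense union which, with the restricted metrics and the normalized Haar
measures (on the Borel σ-algebras), is a Lévy family. (A compact metric space is complete and
separable, so these are metric measure spaces.) -/
def IsLevyMetricGroup (G : Type*) [Group G] [MetricSpace G] : Prop :=
  (∀ x y z : G, dist (x * z) (y * z) = dist x y) ∧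
  ∃ H : ℕ → Subgroup G,
    Monotone H ∧
    (∀ n, IsCompact (H n : Set G)) ∧
    Dense (⋃ n, (H n : Set G)) ∧
    letI : ∀ n, MeasurableSpace (H n) := fun n => borel (H n)
    ∃ μ : ∀ n, Measure (H n),
      (∀ n, (μ n).IsHaarMeasure ∧ IsProbabilityMeasure (μ n)) ∧
      IsLevyFamily (fun n => H n) μ

/-- A topological group is a Lévy group if its topology is induced by some metric for which it
satisfies `IsLevyMetricGroup`. -/
def IsLevyGroup (G : Type*) [Group G] [t : TopologicalSpace G] : Prop :=
  ∃ m : MetricSpace G,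
    m.toPseudoMetricSpace.toUniformSpace.toTopologicalSpace = t ∧ IsLevyMetricGroup G

/-- The infinite-dimensional `ℓ^p`-ball `{x | ∑ |x_n|^p ≤ 1}`, as a subset of `ℓ^q`, from which it
takes the `ℓ^q`-distance. For `p < q` every sequence with `∑ |x_n|^p ≤ 1` lies in `ℓ^q`
(see `memℓp_of_tsum_le_one`), so no sequence is lost. -/
def lpBall (p : ℝ) (q : ℝ≥0∞) : Set (lp (fun _ : ℕ => ℝ) q) :=
  {x | ∑' n, ENNReal.ofReal (|x n| ^ p) ≤ 1}

theorem memℓp_of_tsum_le_one {p : ℝ} {q : ℝ≥0∞} (hp : 1 ≤ p) (hpq : ENNReal.ofReal p < q)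
    (x : ℕ → ℝ) (hx : ∑' n, ENNReal.ofReal (|x n| ^ p) ≤ 1) : Memℓp x q := by
  have hp0 : 0 < p := by linarith
  refine Memℓp.of_exponent_ge (q := ENNReal.ofReal p) ?_ hpq.le
  have hr : (ENNReal.ofReal p).toReal = p := ENNReal.toReal_ofReal hp0.le
  refine memℓp_gen ?_
  rw [hr]
  have hs := ENNReal.summable_toReal (ne_top_of_le_ne_top ENNReal.one_ne_top hx)
  refine hs.congr fun n => ?_
  rw [ENNReal.toReal_ofReal (by positivity), Real.norm_eq_abs]

/-- The action is bounded: for any `ε > 0` there is a neighbourhood `U` of the identity with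
`d(x, gx) < ε` for all `g ∈ U` and all `x`. -/
def IsBoundedAction (G X : Type*) [Group G] [TopologicalSpace G] [MetricSpace X]
    [MulAction G X] : Prop :=
  ∀ ε : ℝ, 0 < ε → ∃ U ∈ 𝓝 (1 : G), ∀ g ∈ U, ∀ x : X, dist x (g • x) < ε

/-- The action is uniformly equicontinuous: for any `ε > 0` there is `δ > 0` such that
`d(gx, gy) < ε` for all `g` and all `x, y` with `d(x, y) < δ`. -/
def IsUniformlyEquicontinuousAction (G X : Type*) [Group G] [MetricSpace X]
    [MulAction G X] : Prop :=
  ∀ ε : ℝ, 0 < ε → ∃ δ : ℝ, 0 < δ ∧ ∀ (g : G) (x y : X), dist x y < δ → dist (g • x) (g • y) < ε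

/-! Fix `x` and look at the orbit maps `h ↦ h • x` on the compact subgroups `H n`. Boundedness and
right invariance make them uniformly continuous, with one modulus for all `n`. By
`exists_measure_compl_le_forall_abs_sub_le` such maps concentrate in the supremum distance:
summability of p-th powers leaves only boundedly many coordinates that are not small on most of the
group, and these concentrate near medians. On the ball small supremum distance forces small
`ℓ^q`-distance, because `p < q` (`exists_forall_abs_sub_le_dist_lt`). So a set `A` of measure above
1/2 has an orbit of small diameter. It contains some `h` together with `h * g`, so `h • x` and `(h *
g) • x` are close. Equicontinuity lets `h⁻¹` be applied, and `x` is close to `g • x`. Density of the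
subgroups gives the rest. -/

/-! ### Concentration of measure. -/

/-- In a Lévy family the complement of the `r`-neighbourhood of a set which is not too small is
eventually small, uniformly over such sets. -/
theorem IsLevyFamily.eventually_measure_compl_thickening_le {X : ℕ → Type*}
    [∀ n, MetricSpace (X n)] [∀ n, MeasurableSpace (X n)] [∀ n, BorelSpace (X n)]
    {μ : ∀ n, Measure (X n)} [∀ n, IsProbabilityMeasure (μ n)] (h : IsLevyFamily X μ)
    {c r : ℝ} (hc : 0 < c) (hr : 0 < r) :
    ∀ᶠ n in atTop, ∀ B : Set (X n), ENNReal.ofReal c ≤ μ n B →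
      μ n (Metric.thickening r B)ᶜ ≤ ENNReal.ofReal c := by
  -- Half of `c` is given away: a set missing mass at most `c / 2` must meet any `B` of mass at
  -- least `c`.
  have hev := (h (c / 2) (by positivity)).eventually_lt_const (ENNReal.ofReal_pos.2 hr)
  filter_upwards [hev] with n hn B hB
  have hcpos : 0 < ENNReal.ofReal c := ENNReal.ofReal_pos.2 hc
  have hc2 : ENNReal.ofReal (c / 2) < ENNReal.ofReal c := by
    rw [ENNReal.ofReal_lt_ofReal_iff hc]; linarith
  have hBne : B.Nonempty := by
    by_contra hne
    rw [Set.not_nonempty_iff_eq_empty.1 hne, measure_empty] at hB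
    exact absurd hB (not_le.2 hcpos)
  set f : X n → ℝ := fun x => Metric.infDist x B with hf
  have hfl : LipschitzWith 1 f := Metric.lipschitz_infDist_pt B
  have hfm : Measurable f := hfl.continuous.measurable
  have hpd : partialDiam ((μ n).map f) (c / 2) < ENNReal.ofReal r :=
    lt_of_le_of_lt (le_iSup₂ (f := fun (f : X n → ℝ) (_ : LipschitzWith 1 f) =>
      partialDiam ((μ n).map f) (c / 2)) f hfl) hn
  simp only [partialDiam, iInf_lt_iff] at hpd
  obtain ⟨Y, hY, hYm, hYd⟩ := hpd
  rw [Measure.map_apply hfm MeasurableSet.univ, Measure.map_apply hfm hY, Set.preimage_univ,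
    measure_univ] at hYm
  have hcompl : μ n (f ⁻¹' Y)ᶜ ≤ ENNReal.ofReal (c / 2) := by
    rw [prob_compl_eq_one_sub (hfm hY)]
    exact tsub_le_iff_tsub_le.1 hYm
  have hmeet : (B ∩ f ⁻¹' Y).Nonempty := by
    by_contra hne
    have hsub : B ⊆ (f ⁻¹' Y)ᶜ := fun x hx hxY => hne ⟨x, hx, hxY⟩
    exact absurd (hB.trans ((measure_mono hsub).trans hcompl)) (not_le.2 hc2)
  obtain ⟨b, hbB, hbY⟩ := hmeet
  have hb0 : f b = 0 := Metric.infDist_zero_of_mem hbB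
  refine (measure_mono (Set.compl_subset_compl.2 fun x hx => ?_)).trans (hcompl.trans hc2.le)
  rw [Metric.mem_thickening_iff_infDist_lt hBne]
  have hxb : edist (f x) (f b) < ENNReal.ofReal r :=
    (Metric.edist_le_ediam_of_mem (s := Y) hx hbY).trans_lt hYd
  rw [hb0, edist_dist, ENNReal.ofReal_lt_ofReal_iff hr, Real.dist_eq, sub_zero] at hxb
  exact (le_abs_self _).trans_lt hxb

/-- Greedy selection. If unions of `S i` that are not small come with unions of `S' i` that are
almost everything, then either almost every point lies in `k` of the sets `S' i`, or after removing
`k` indices the union of the sets `S i` is small. -/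
theorem exists_card_eq_mem_or_measure_biUnion_le {X : Type*} [MeasurableSpace X] (μ : Measure X)
    (S S' : ℕ → Set X) {c : ℝ≥0∞} (hc : 0 < c)
    (h : ∀ I : Finset ℕ, c ≤ μ (⋃ i ∈ I, S i) → μ (⋃ i ∈ I, S' i)ᶜ ≤ c) (k : ℕ) (T : Set ℕ) :
    (∃ E : Set X, μ Eᶜ ≤ k * c ∧
      ∀ x ∈ E, ∃ Q : Finset ℕ, (Q : Set ℕ) ⊆ T ∧ Q.card = k ∧ ∀ i ∈ Q, x ∈ S' i) ∨
    ∃ J : Finset ℕ, J.card ≤ k ∧ μ (⋃ i ∈ T \ J, S i) ≤ k * c := by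
  classical
  induction k generalizing T with
  | zero => exact Or.inl ⟨Set.univ, by simp, fun x _ => ⟨∅, by simp⟩⟩
  | succ k ih =>
    by_cases hT : μ (⋃ i ∈ T, S i) ≤ c
    · refine Or.inr ⟨∅, by simp, ?_⟩
      rw [Finset.coe_empty, Set.sdiff_empty]
      exact hT.trans (le_mul_of_one_le_left zero_le (by simp))
    -- Take the shortest initial segment of `T` whose union has mass at least `c`. Its sets `S' i`
    -- cover almost everything, which supplies one index; the induction hypothesis on the rest of
    -- `T` supplies the others. If the rest fails, only the last index `n` of the segment need be
    -- removed, as by minimality the shorter segment has mass below `c`.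
    set I : ℕ → Finset ℕ := fun n => (Finset.range n).filter (· ∈ T) with hI
    have hmem : ∀ n i, i ∈ I n ↔ i < n ∧ i ∈ T := fun n i => by simp [hI]
    have hIn : ∃ n, c ≤ μ (⋃ i ∈ I n, S i) := by
      have hmono : Monotone fun n => ⋃ i ∈ I n, S i := fun m n hmn =>
        Set.biUnion_subset_biUnion_left fun i hi =>
          (hmem n i).2 ⟨((hmem m i).1 hi).1.trans_le hmn, ((hmem m i).1 hi).2⟩
      have hU : ⋃ n, ⋃ i ∈ I n, S i = ⋃ i ∈ T, S i := by
        ext x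
        simp only [Set.mem_iUnion, hmem, exists_prop]
        exact ⟨fun ⟨_, i, hi, hx⟩ => ⟨i, hi.2, hx⟩,
          fun ⟨i, hi, hx⟩ => ⟨i + 1, i, ⟨i.lt_succ_self, hi⟩, hx⟩⟩
      rw [← hU, hmono.measure_iUnion, not_le, lt_iSup_iff] at hT
      exact hT.imp fun _ => le_of_lt
    have hn0 : Nat.find hIn ≠ 0 := fun h0 => by
      have := Nat.find_spec hIn
      rw [h0] at this
      simp [hI, hc.ne'] at this
    obtain ⟨n, hn⟩ := Nat.exists_eq_succ_of_ne_zero hn0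
    have hbig : c ≤ μ (⋃ i ∈ I (n + 1), S i) := by
      have := Nat.find_spec hIn
      rwa [hn] at this
    have hsmall : μ (⋃ i ∈ I n, S i) < c :=
      not_le.1 (Nat.find_min hIn (hn ▸ n.lt_succ_self))
    rcases ih (T \ I (n + 1)) with ⟨E, hE, hEQ⟩ | ⟨J, hJ, hJm⟩
    · refine Or.inl ⟨E ∩ ⋃ i ∈ I (n + 1), S' i, ?_, ?_⟩
      · rw [Set.compl_inter]
        refine (measure_union_le _ _).trans ((add_le_add hE (h _ hbig)).trans_eq ?_)
        push_cast; ring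
      · rintro x ⟨hxE, hxI⟩
        obtain ⟨Q, hQT, hQc, hQ⟩ := hEQ x hxE
        simp only [Set.mem_iUnion, exists_prop] at hxI
        obtain ⟨i, hi, hxi⟩ := hxI
        have hiQ : i ∉ Q := fun hiQ => (hQT hiQ).2 hi
        refine ⟨insert i Q, ?_, by rw [Finset.card_insert_of_notMem hiQ, hQc], ?_⟩
        · rw [Finset.coe_insert]
          exact Set.insert_subset ((hmem _ _).1 hi).2 (hQT.trans Set.sdiff_subset)
        · intro j hj
          rcases Finset.mem_insert.1 hj with rfl | hj
          exacts [hxi, hQ j hj]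
    · refine Or.inr ⟨insert n J, (Finset.card_insert_le _ _).trans (Nat.succ_le_succ hJ), ?_⟩
      have hsub : ⋃ i ∈ T \ (insert n J : Finset ℕ), S i ⊆
          (⋃ i ∈ (T \ I (n + 1)) \ J, S i) ∪ ⋃ i ∈ I n, S i := by
        intro x hx
        simp only [Set.mem_iUnion, exists_prop] at hx
        obtain ⟨i, ⟨hiT, hiJ⟩, hxi⟩ := hx
        rw [Finset.mem_coe, Finset.mem_insert, not_or] at hiJ
        by_cases hi : i < n
        · exact Or.inr (Set.mem_biUnion ((hmem n i).2 ⟨hi, hiT⟩) hxi)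
        · refine Or.inl (Set.mem_biUnion (x := i) ⟨⟨hiT, fun hi' => ?_⟩, hiJ.2⟩ hxi)
          have := ((hmem (n + 1) i).1 hi').1
          omega
      refine (measure_mono hsub).trans ((measure_union_le _ _).trans
        ((add_le_add hJm hsmall.le).trans_eq ?_))
      push_cast; ring

/-- A bounded real function is within `2 * t` of a constant off a small set if the
sets which are not small have large neighbourhoods, and the function oscillates by less than `t` at
scale `r`. -/
theorem exists_measure_abs_sub_gt_le {X : Type*} [MetricSpace X] [MeasurableSpace X]
    {μ : Measure X} [IsProbabilityMeasure μ] {c : ℝ≥0∞} (hc : c ≤ 2⁻¹) {r t b : ℝ} (ht : 0 < t)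
    (hconc : ∀ B : Set X, c ≤ μ B → μ (Metric.thickening r B)ᶜ ≤ c)
    {f : X → ℝ} (hf : ∀ x y, dist x y < r → |f x - f y| < t) (hb : ∀ x, |f x| ≤ b) :
    ∃ m : ℝ, μ {x | 2 * t < |f x - m|} ≤ 2 * c := by
  obtain ⟨M, hM⟩ := exists_nat_gt (b / t)
  rw [div_lt_iff₀ ht] at hM
  -- A median on the grid of step `t`: `f` is at least `k * t`, and also below `(k + 1) * t`, with
  -- probability at least one half. The error `2 * t` is a grid step plus an oscillation.
  obtain ⟨k, hk, hkmax⟩ := Int.exists_greatest_of_bdd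
    (P := fun k : ℤ => 2⁻¹ ≤ μ {x | k * t ≤ f x})
    ⟨M, fun z hz => by
      by_contra hlt
      have hzM : (M : ℝ) ≤ z := by exact_mod_cast (not_le.1 hlt).le
      have hempty : {x | z * t ≤ f x} = ∅ := Set.eq_empty_iff_forall_notMem.2 fun x hx => by
        have h1 := (abs_le.1 (hb x)).2
        have h2 : (M : ℝ) * t ≤ z * t := mul_le_mul_of_nonneg_right hzM ht.le
        have h3 : z * t ≤ f x := hx
        linarith
      rw [hempty] at hz
      simp at hz⟩
    ⟨-M, by
      have huniv : {x | ((-M : ℤ) : ℝ) * t ≤ f x} = Set.univ := Set.eq_univ_of_forall fun x => by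
        have h1 := (abs_le.1 (hb x)).1
        simp only [Set.mem_ofPred_eq]
        push_cast
        linarith
      rw [huniv, measure_univ]
      exact ENNReal.inv_le_one.2 one_le_two⟩
  have hk' : 2⁻¹ ≤ μ {x | f x < (k + 1) * t} := by
    by_contra hlt
    have h1 : μ {x | ((k + 1 : ℤ) : ℝ) * t ≤ f x} < 2⁻¹ :=
      not_le.1 fun h => absurd (hkmax _ h) (by omega)
    have h2 : (1 : ℝ≥0∞) ≤ μ {x | f x < (k + 1) * t} + μ {x | ((k + 1 : ℤ) : ℝ) * t ≤ f x} := by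
      rw [← measure_univ (μ := μ)]
      refine (measure_mono fun x _ => ?_).trans (measure_union_le _ _)
      rcases lt_or_ge (f x) ((k + 1) * t) with h | h
      · exact Or.inl h
      · exact Or.inr (by simpa using h)
    have h3 := ENNReal.add_lt_add (not_le.1 hlt) h1
    rw [ENNReal.inv_two_add_inv_two] at h3
    exact absurd h2 (not_le.2 h3)
  refine ⟨k * t, ?_⟩
  have hsub : {x | 2 * t < |f x - k * t|} ⊆ (Metric.thickening r {x | k * t ≤ f x})ᶜ ∪
      (Metric.thickening r {x | f x < (k + 1) * t})ᶜ := by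
    intro x hx
    by_contra hnot
    simp only [Set.mem_union, Set.mem_compl_iff, not_or, not_not, Metric.mem_thickening_iff] at hnot
    obtain ⟨⟨y, hy, hxy⟩, ⟨z, hz, hxz⟩⟩ := hnot
    have h1 := abs_lt.1 (hf x y hxy)
    have h2 := abs_lt.1 (hf x z hxz)
    simp only [Set.mem_ofPred_eq] at hy hz hx
    refine absurd hx (not_lt.2 (abs_le.2 ⟨?_, ?_⟩)) <;> linarith
  refine (measure_mono hsub).trans ((measure_union_le _ _).trans
    ((add_le_add (hconc _ (hc.trans hk)) (hconc _ (hc.trans hk'))).trans_eq (two_mul c).symm))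

/-- Maps into the `ℓ^p`-ball concentrate in the supremum distance. -/
theorem exists_measure_compl_le_forall_abs_sub_le {X : Type*} [MetricSpace X] [MeasurableSpace X]
    {μ : Measure X} [IsProbabilityMeasure μ] {c : ℝ≥0∞} {r t p : ℝ} {k : ℕ}
    (ht : 0 < t) (hp : 0 < p) (hk : 1 < k * t ^ p) (hc0 : 0 < c) (hkc : k * c ≤ 2⁻¹)
    (hconc : ∀ B : Set X, c ≤ μ B → μ (Metric.thickening r B)ᶜ ≤ c)
    {φ : X → ℕ → ℝ} (hφ : ∀ x y, dist x y < r → ∀ i, |φ x i - φ y i| < t)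
    (hφp : ∀ x, ∑' i, ENNReal.ofReal (|φ x i| ^ p) ≤ 1) :
    ∃ A : Set X, μ Aᶜ ≤ 3 * (k * c) ∧ ∀ x ∈ A, ∀ y ∈ A, ∀ i, |φ x i - φ y i| ≤ 4 * t := by
  have hk0 : k ≠ 0 := by
    rintro rfl
    simp at hk
    linarith
  have hc2 : c ≤ 2⁻¹ :=
    (le_mul_of_one_le_left zero_le (by exact_mod_cast Nat.one_le_iff_ne_zero.2 hk0)).trans hkc
  have hone : ∀ x i, |φ x i| ≤ 1 := fun x i => by
    have h1 := (ENNReal.le_tsum i).trans (hφp x)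
    rw [ENNReal.ofReal_le_one] at h1
    by_contra hlt
    exact absurd h1 (not_le.2 (Real.one_lt_rpow (not_le.1 hlt) hp))
  have hgreedy := exists_card_eq_mem_or_measure_biUnion_le μ (fun i => {x | 2 * t < |φ x i|})
    (fun i => {x | t < |φ x i|}) hc0 (fun I hI => by
      refine (measure_mono (Set.compl_subset_compl.2 fun x hx => ?_)).trans (hconc _ hI)
      obtain ⟨y, hy, hxy⟩ := Metric.mem_thickening_iff.1 hx
      simp only [Set.mem_iUnion, Set.mem_ofPred_eq, exists_prop] at hy ⊢
      obtain ⟨i, hi, hyi⟩ := hy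
      refine ⟨i, hi, ?_⟩
      have h1 := hφ x y hxy i
      have h2 := abs_sub_abs_le_abs_sub (φ y i) (φ x i)
      rw [abs_sub_comm] at h2
      linarith) k Set.univ
  rcases hgreedy with ⟨E, hE, hEQ⟩ | ⟨J, hJ, hJm⟩
  -- A point with `k` coordinates above `t` would have p-th power sum above `k * t ^ p > 1`.
  · exfalso
    have hEne : E.Nonempty := by
      by_contra hne
      rw [Set.not_nonempty_iff_eq_empty.1 hne, Set.compl_empty, measure_univ] at hE
      exact absurd (hE.trans hkc) (not_le.2 (ENNReal.inv_lt_one.2 ENNReal.one_lt_two))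
    obtain ⟨x, hx⟩ := hEne
    obtain ⟨Q, -, hQc, hQ⟩ := hEQ x hx
    have h1 : ∑ i ∈ Q, ENNReal.ofReal (|φ x i| ^ p) ≤ 1 := (ENNReal.sum_le_tsum Q).trans (hφp x)
    rw [← ENNReal.ofReal_sum_of_nonneg fun i _ => by positivity, ENNReal.ofReal_le_one] at h1
    have h2 : ∑ _i ∈ Q, t ^ p ≤ ∑ i ∈ Q, |φ x i| ^ p :=
      Finset.sum_le_sum fun i hi => Real.rpow_le_rpow ht.le (hQ i hi).le hp.le
    rw [Finset.sum_const, hQc, nsmul_eq_mul] at h2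
    linarith
  · have hmed : ∀ i, ∃ m : ℝ, μ {x | 2 * t < |φ x i - m|} ≤ 2 * c := fun i =>
      exists_measure_abs_sub_gt_le hc2 ht hconc (fun x y hxy => hφ x y hxy i) fun x => hone x i
    choose m hm using hmed
    refine ⟨((⋃ i ∈ Set.univ \ (J : Set ℕ), {x | 2 * t < |φ x i|}) ∪
      ⋃ i ∈ J, {x | 2 * t < |φ x i - m i|})ᶜ, ?_, ?_⟩
    · rw [compl_compl]
      refine (measure_union_le _ _).trans ((add_le_add hJm (?_ : _ ≤ 2 * (k * c))).trans_eq ?_)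
      · refine (measure_biUnion_finset_le _ _).trans ((Finset.sum_le_sum fun i _ => hm i).trans ?_)
        rw [Finset.sum_const, nsmul_eq_mul, mul_left_comm]
        gcongr
      · ring
    · have key : ∀ i, ∃ a : ℝ, ∀ x ∈ ((⋃ i ∈ Set.univ \ (J : Set ℕ), {x | 2 * t < |φ x i|}) ∪
          ⋃ i ∈ J, {x | 2 * t < |φ x i - m i|})ᶜ, |φ x i - a| ≤ 2 * t := by
        intro i
        by_cases hi : i ∈ J
        · refine ⟨m i, fun x hx => not_lt.1 fun hlt => hx (Or.inr ?_)⟩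
          exact Set.mem_biUnion (x := i) hi hlt
        · refine ⟨0, fun x hx => not_lt.1 fun hlt => hx (Or.inl ?_)⟩
          rw [sub_zero] at hlt
          exact Set.mem_biUnion (x := i) ⟨Set.mem_univ _, hi⟩ hlt
      intro x hx y hy i
      obtain ⟨a, ha⟩ := key i
      have h1 := abs_le.1 (ha x hx)
      have h2 := abs_le.1 (ha y hy)
      exact abs_le.2 ⟨by linarith, by linarith⟩

/-! ### Comparison of distances on the ball. -/

/-- On the `ℓ^p`-ball the `ℓ^q`-distance is uniformly controlled by the supremum distance. -/
theorem exists_forall_abs_sub_le_dist_lt {p : ℝ} {q : ℝ≥0∞} [Fact (1 ≤ q)] (hp : 1 ≤ p)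
    (hpq : ENNReal.ofReal p < q) {δ : ℝ} (hδ : 0 < δ) :
    ∃ s : ℝ, 0 < s ∧ ∀ x y : lpBall p q,
      (∀ i, |(x : lp (fun _ : ℕ => ℝ) q) i - (y : lp (fun _ : ℕ => ℝ) q) i| ≤ s) →
      dist x y < δ := by
  have hp0 : 0 < p := by linarith
  rcases eq_or_ne q ∞ with rfl | hq
  · refine ⟨δ / 2, by positivity, fun x y hxy => ?_⟩
    rw [Subtype.dist_eq, dist_eq_norm]
    refine lt_of_le_of_lt (lp.norm_le_of_forall_le (half_pos hδ).le fun i => ?_) (half_lt_self hδ)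
    exact hxy i
  have hpq' : p < q.toReal := (ENNReal.ofReal_lt_iff_lt_toReal hp0.le hq).1 hpq
  set u := q.toReal with hu
  have hu0 : 0 < u := hp0.trans hpq'
  have hlim : Tendsto (fun s : ℝ => s ^ (u - p) * (2 ^ p * 2)) (𝓝[>] 0) (𝓝 0) := by
    have h1 : Tendsto (fun s : ℝ => s ^ (u - p) * (2 ^ p * 2)) (𝓝 0)
        (𝓝 ((0 : ℝ) ^ (u - p) * (2 ^ p * 2))) :=
      ((Real.continuousAt_rpow_const 0 (u - p) (Or.inr (by linarith))).tendsto).mul_const _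
    rw [Real.zero_rpow (by linarith), zero_mul] at h1
    exact h1.mono_left nhdsWithin_le_nhds
  obtain ⟨s, hs, hs0⟩ := ((hlim.eventually_lt_const
    (Real.rpow_pos_of_pos (half_pos hδ) u)).and self_mem_nhdsWithin).exists
  refine ⟨s, hs0, fun x y hxy => ?_⟩
  rw [Subtype.dist_eq, dist_eq_norm]
  refine lt_of_le_of_lt (lp.norm_le_of_forall_sum_le (hu ▸ hu0) (half_pos hδ).le fun Q => ?_)
    (half_lt_self hδ)
  rw [← hu]
  have hball : ∀ z : lpBall p q, ∑ i ∈ Q, |(z : lp (fun _ : ℕ => ℝ) q) i| ^ p ≤ 1 := fun z => by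
    have h1 := (ENNReal.sum_le_tsum Q).trans z.2
    rwa [← ENNReal.ofReal_sum_of_nonneg fun i _ => by positivity, ENNReal.ofReal_le_one] at h1
  -- Interpolation: `u - p` of the `u` factors are bounded by `s`, and the remaining p-th powers
  -- have bounded sum.
  have hterm : ∀ a b : ℝ, |a - b| ≤ s →
      |a - b| ^ u ≤ s ^ (u - p) * (2 ^ p * (|a| ^ p + |b| ^ p)) := by
    intro a b hab
    have h1 : |a - b| ^ p ≤ 2 ^ p * (|a| ^ p + |b| ^ p) := by
      have h2 : |a - b| ≤ 2 * max |a| |b| :=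
        (abs_sub a b).trans (by linarith [le_max_left |a| |b|, le_max_right |a| |b|])
      refine (Real.rpow_le_rpow (abs_nonneg _) h2 hp0.le).trans ?_
      rw [Real.mul_rpow zero_le_two (by positivity)]
      refine mul_le_mul_of_nonneg_left ?_ (by positivity)
      have ha : 0 ≤ |a| ^ p := by positivity
      have hb : 0 ≤ |b| ^ p := by positivity
      rcases max_choice |a| |b| with h | h <;> rw [h] <;> linarith
    rw [show u = (u - p) + p by ring, Real.rpow_add_of_nonneg (abs_nonneg _) (by linarith) hp0.le,
      add_sub_cancel_right]
    exact mul_le_mul (Real.rpow_le_rpow (abs_nonneg _) hab (by linarith)) h1 (by positivity)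
      (by positivity)
  calc ∑ i ∈ Q, ‖((x : lp (fun _ : ℕ => ℝ) q) - y) i‖ ^ u
      ≤ ∑ i ∈ Q, s ^ (u - p) * (2 ^ p * (|(x : lp (fun _ : ℕ => ℝ) q) i| ^ p +
          |(y : lp (fun _ : ℕ => ℝ) q) i| ^ p)) :=
        Finset.sum_le_sum fun i _ => hterm _ _ (hxy i)
    _ = s ^ (u - p) * (2 ^ p * (∑ i ∈ Q, |(x : lp (fun _ : ℕ => ℝ) q) i| ^ p +
          ∑ i ∈ Q, |(y : lp (fun _ : ℕ => ℝ) q) i| ^ p)) := by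
        rw [← Finset.mul_sum, ← Finset.mul_sum, Finset.sum_add_distrib]
    _ ≤ s ^ (u - p) * (2 ^ p * 2) := by
        have := hball x
        have := hball y
        gcongr
        linarith
    _ ≤ (δ / 2) ^ u := hs.le

/-! ### Group actions and the conclusion. -/

/-- Compact groups are unimodular. -/
theorem isMulRightInvariant_of_isHaarMeasure_of_isProbabilityMeasure {K : Type*} [Group K]
    [TopologicalSpace K] [IsTopologicalGroup K] [LocallyCompactSpace K] [MeasurableSpace K]
    [BorelSpace K] (μ : Measure K) [μ.IsHaarMeasure] [IsProbabilityMeasure μ] :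
    μ.IsMulRightInvariant := by
  refine ⟨fun g => ?_⟩
  have : IsProbabilityMeasure (μ.map (· * g)) :=
    Measure.isProbabilityMeasure_map (measurable_mul_const g).aemeasurable
  exact Measure.isHaarMeasure_eq_of_isProbabilityMeasure _ _

/-- A set of measure more than one half meets each of its right translates. -/
theorem exists_mem_mul_mem_of_measure_compl_lt {K : Type*} [Group K] [MeasurableSpace K]
    [MeasurableMul K] {μ : Measure K} [μ.IsMulRightInvariant] [IsProbabilityMeasure μ] {A : Set K}
    (hA : μ Aᶜ < 2⁻¹) (g : K) : ∃ h ∈ A, h * g ∈ A := by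
  by_contra! hne
  have h1 : (1 : ℝ≥0∞) ≤ μ Aᶜ + μ ((fun h => h * g) ⁻¹' Aᶜ) := by
    rw [← measure_univ (μ := μ)]
    refine (measure_mono fun h _ => ?_).trans (measure_union_le _ _)
    by_cases hh : h ∈ A
    · exact Or.inr (hne h hh)
    · exact Or.inl hh
  rw [measure_preimage_mul_right] at h1
  have h2 := ENNReal.add_lt_add hA hA
  rw [ENNReal.inv_two_add_inv_two] at h2
  exact absurd h1 (not_le.2 h2)

/-- Right invariance puts `g * h⁻¹` near the identity, and it moves `h • x` to `g • x`. The radius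
does not depend on `x`. -/
theorem IsBoundedAction.exists_dist_smul_lt {G X : Type*} [Group G] [MetricSpace G] [MetricSpace X]
    [MulAction G X] (hbdd : IsBoundedAction G X)
    (hinv : ∀ x y z : G, dist (x * z) (y * z) = dist x y) {t : ℝ} (ht : 0 < t) :
    ∃ r : ℝ, 0 < r ∧ ∀ (g h : G) (x : X), dist g h < r → dist (g • x) (h • x) < t := by
  obtain ⟨U, hU, hUt⟩ := hbdd t ht
  obtain ⟨r, hr, hrU⟩ := Metric.mem_nhds_iff.1 hU
  refine ⟨r, hr, fun g h x hgh => ?_⟩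
  have hmem : g * h⁻¹ ∈ U := hrU <| by
    rwa [Metric.mem_ball, ← hinv _ _ h, inv_mul_cancel_right, one_mul]
  have h1 := hUt _ hmem (h • x)
  rwa [smul_smul, inv_mul_cancel_right, dist_comm] at h1

theorem corollary1p3 (p : ℝ) (q : ℝ≥0∞) [Fact (1 ≤ q)] (hp : 1 ≤ p) (hpq : ENNReal.ofReal p < q)
    (G : Type*) [Group G] [TopologicalSpace G] [IsTopologicalGroup G] (hG : IsLevyGroup G)
    [MulAction G (lpBall p q)]
    (hbdd : IsBoundedAction G (lpBall p q))
    (hequi : IsUniformlyEquicontinuousAction G (lpBall p q)) :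
    ∀ (g : G) (x : lpBall p q), g • x = x := by
  obtain ⟨m, rfl, hinv, H, hHmono, hHcomp, hHdense, hμ⟩ := hG
  let _ : ∀ n, MeasurableSpace (H n) := fun n => borel (H n)
  have : ∀ n, BorelSpace (H n) := fun n => ⟨rfl⟩
  obtain ⟨μ, hμ, hlevy⟩ := hμ
  have : ∀ n, (μ n).IsHaarMeasure := fun n => (hμ n).1
  have : ∀ n, IsProbabilityMeasure (μ n) := fun n => (hμ n).2
  have : ∀ n, CompactSpace (H n) := fun n => isCompact_iff_compactSpace.1 (hHcomp n)
  have hp0 : 0 < p := by linarith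
  have hq0 : q ≠ 0 := (zero_le.trans_lt hpq).ne'
  intro g x
  have hcont : Continuous fun g : G => g • x := Metric.continuous_iff.2 fun b ε hε => by
    obtain ⟨r, hr, h⟩ := hbdd.exists_dist_smul_lt hinv hε
    exact ⟨r, hr, fun a hab => h a b x hab⟩
  suffices hfix : ∀ m (g : H m), (g : G) • x = x by
    have hclosed : IsClosed {g : G | g • x = x} := isClosed_eq hcont continuous_const
    have hsub : (⋃ n, (H n : Set G)) ⊆ {g : G | g • x = x} :=
      Set.iUnion_subset fun n g hg => hfix n ⟨g, hg⟩
    exact hclosed.closure_subset_iff.2 hsub (hHdense g)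
  clear g
  intro m g
  refine (dist_le_zero.1 (le_of_forall_pos_le_add fun ε hε => ?_)).symm
  rw [zero_add]
  obtain ⟨δ, hδ, hequi⟩ := hequi ε hε
  obtain ⟨s, hs, hsδ⟩ := exists_forall_abs_sub_le_dist_lt hp hpq hδ
  have ht : 0 < s / 4 := by positivity
  have htp : 0 < (s / 4) ^ p := Real.rpow_pos_of_pos ht p
  obtain ⟨r, hr, hrt⟩ := hbdd.exists_dist_smul_lt hinv ht
  obtain ⟨k, hk⟩ := exists_nat_gt (1 / (s / 4) ^ p)
  have hk0 : (0 : ℝ) < k := lt_trans (by positivity) hk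
  rw [div_lt_iff₀ htp] at hk
  have hkc : (k : ℝ≥0∞) * ENNReal.ofReal (1 / (8 * k)) = ENNReal.ofReal (1 / 8) := by
    rw [← ENNReal.ofReal_natCast, ← ENNReal.ofReal_mul hk0.le]
    congr 1
    field_simp
  have hhalf : (2⁻¹ : ℝ≥0∞) = ENNReal.ofReal (1 / 2) := by
    rw [one_div, ENNReal.ofReal_inv_of_pos two_pos, ENNReal.ofReal_ofNat]
  -- With `c = 1 / (8 * k)` the exceptional set has mass at most `3 / 8 < 1 / 2`; `t = s / 4` turns
  -- the spread `4 * t` into `s`. Taking `n ≥ m` keeps `g` in `H n`.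
  obtain ⟨n, hconc, hmn⟩ := ((hlevy.eventually_measure_compl_thickening_le
    (c := 1 / (8 * k)) (by positivity) hr).and (eventually_ge_atTop m)).exists
  obtain ⟨A, hA, hAs⟩ := exists_measure_compl_le_forall_abs_sub_le ht hp0 hk
    (ENNReal.ofReal_pos.2 (by positivity))
    (by rw [hkc, hhalf]; exact ENNReal.ofReal_le_ofReal (by norm_num)) hconc
    (φ := fun h i => (((h : G) • x : lpBall p q) : lp (fun _ : ℕ => ℝ) q) i)
    (fun a b hab i => by
      have h1 := hrt a b x hab
      rw [Subtype.dist_eq, dist_eq_norm] at h1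
      exact (lp.norm_apply_le_norm hq0 _ i).trans_lt h1)
    (fun h => ((h : G) • x).2)
  have hA2 : μ n Aᶜ < 2⁻¹ := by
    refine hA.trans_lt ?_
    rw [hkc, hhalf, ← ENNReal.ofReal_ofNat, ← ENNReal.ofReal_mul (by norm_num),
      ENNReal.ofReal_lt_ofReal_iff (by norm_num)]
    norm_num
  have := isMulRightInvariant_of_isHaarMeasure_of_isProbabilityMeasure (μ n)
  obtain ⟨h, hh, hhg⟩ := exists_mem_mul_mem_of_measure_compl_lt hA2 ⟨(g : G), hHmono hmn g.2⟩
  have hd := hsδ ((h : G) • x) (((h : G) * (g : G)) • x) fun i =>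
    (hAs h hh _ hhg i).trans_eq (by ring)
  have hd' := hequi (h : G)⁻¹ _ _ hd
  rw [inv_smul_smul, smul_smul, inv_mul_cancel_left] at hd'
  exact hd'.le
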